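/- Let $R$ be a nonzero associative ring with $1$, not necessarily commutative. A left Ore set of $R$ is a subset $S\subseteq R$ closed under multiplication, with $1\in S$ and $0\notin S$, such that $Sr\cap Rs\neq\emptyset$ for all $r\in R$, $s\in S$. For such $S$ put $\mathrm{ass}(S)=\{r\in R : sr=0 \text{ for some } s\in S\}$, an ideal of $R$. A left denominator set is a left Ore set $S$ such that $rs=0$ with $r\in R$, $s\in S$ implies $r\in\mathrm{ass}(S)$; then $S^{-1}R$ denotes the left localization (left ring of fractions) of $R$ at $S$. Let $\max.\mathrm{Den}_l(R)$ be the set of left denominator sets that are maximal under inclusion. Further, let - $\mathcal C_R$ be the set of regular elements (two-sided non-zero-divisors) of $R$, and, if $\mathcal C_R$ is a left Ore set, $Q_{l,cl}(R)=\mathcal C_R^{-1}R$ the classical left quotient ring; - $S_{l,0}(R)$ be the largest left denominator set $S$ of $R$ with $\mathrm{ass}(S)=0$ (it exists), and $Q_l(R)=S_{l,0}(R)^{-1}R$ the largest left quotient ring; - $\mathcal L^s_l(R)=\bigcap_{S\in\max.\mathrm{Den}_l(R)}S$ be the set of strongly left localizable elements, $T_l(R)$ the largest left denominator set of $R$ contained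 in $\mathcal L^s_l(R)$ (it exists), $Q^s_l(R)=T_l(R)^{-1}R$ the largest strong left quotient ring, and $\mathfrak l^s_R=\mathrm{ass}(T_l(R))$ the strong left localization radical. **Theorem.** The following statements are equivalent: 1. $Q_{l,cl}(R)$ exists (that is, $\mathcal C_R$ is a left Ore set) and is a semisimple ring. 2. $Q_l(R)$ is a semisimple ring. 3. $Q^s_l(R)$ is a semisimple ring and $\mathfrak l^s_R=0$. If one of these equivalent conditions holds, then $Q_{l,cl}(R)\simeq Q_l(R)\simeq Q^s_l(R)$, by ring isomorphisms compatible with the canonical maps from $R$, and $\mathcal C_R=T_l(R)=\mathcal L^s_l(R)$. -/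

import Mathlib

namespace StrongQuot

universe u

variable {R : Type u} [Ring R]

/-- `ass S` is the set of all `r` in `R` such that `s * r = 0` for some `s` in `S`. -/
def ass (S : Submonoid R) : Set R := {r | ∃ s ∈ S, s * r = 0}

/-- A left Ore set: a multiplicative set `S` with `1 ∈ S`, `0 ∉ S`, such that `S r ∩ R s` is
non-empty for all `r` in `R` and `s` in `S`. -/
structure IsLeftOreSet (S : Submonoid R) : Prop where
  zero_notMem : (0 : R) ∉ S
  ore : ∀ (r : R), ∀ s ∈ S, ∃ s' ∈ S, ∃ r' : R, s' * r = r' * s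

/-- A left denominator set: a left Ore set `S` such that `r * s = 0` with `s ∈ S` implies
`t * r = 0` for some `t ∈ S`. -/
structure IsLeftDenominatorSet (S : Submonoid R) : Prop extends IsLeftOreSet S where
  reversible : ∀ (r : R), ∀ s ∈ S, r * s = 0 → r ∈ ass S

/-- For a left Ore set `S`, the set `ass S` is a two-sided ideal. -/
def IsLeftOreSet.assIdeal {S : Submonoid R} (h : IsLeftOreSet S) : TwoSidedIdeal R :=
  TwoSidedIdeal.mk' (ass S) ⟨1, S.one_mem, mul_zero 1⟩
    (by
      rintro x y ⟨s, hs, hx⟩ ⟨t, ht, hy⟩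
      obtain ⟨s', hs', r', e⟩ := h.ore s t ht
      refine ⟨s' * s, S.mul_mem hs' hs, ?_⟩
      rw [mul_add, mul_assoc s' s x, hx, e, mul_assoc r' t y, hy, mul_zero, mul_zero, add_zero])
    (by
      rintro x ⟨s, hs, hx⟩
      exact ⟨s, hs, by rw [mul_neg, hx, neg_zero]⟩)
    (by
      rintro x y ⟨s, hs, hy⟩
      obtain ⟨s', hs', r', e⟩ := h.ore x s hs
      exact ⟨s', hs', by rw [← mul_assoc, e, mul_assoc, hy, mul_zero]⟩)
    (by
      rintro x y ⟨s, hs, hx⟩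
      exact ⟨s, hs, by rw [← mul_assoc, hx, zero_mul]⟩)

theorem IsLeftOreSet.mem_assIdeal {S : Submonoid R} (h : IsLeftOreSet S) (r : R) :
    r ∈ h.assIdeal ↔ ∃ s ∈ S, s * r = 0 :=
  TwoSidedIdeal.mem_mk' _ _ _ _ _ _ r

theorem IsLeftDenominatorSet.nonempty_oreSet {S : Submonoid R} (h : IsLeftDenominatorSet S) :
    Nonempty (OreLocalization.OreSet S) := by
  rw [OreLocalization.nonempty_oreSet_iff]
  refine ⟨fun r₁ r₂ s e => ?_, fun r s => ?_⟩
  · obtain ⟨t, ht, e'⟩ := h.reversible (r₁ - r₂) s s.2 (by rw [sub_mul, e, sub_self])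
    exact ⟨⟨t, ht⟩, by rwa [mul_sub, sub_eq_zero] at e'⟩
  · obtain ⟨s', hs', r', e⟩ := h.ore r s s.2
    exact ⟨r', ⟨s', hs'⟩, e⟩

/-- Chosen Ore data of a left denominator set, in the form used by `OreLocalization`. -/
noncomputable abbrev IsLeftDenominatorSet.oreSet {S : Submonoid R} (h : IsLeftDenominatorSet S) :
    OreLocalization.OreSet S :=
  h.nonempty_oreSet.some

/-- The left localization `S⁻¹R` of `R` at a left denominator set `S`. -/
noncomputable abbrev LeftLocalization (S : Submonoid R) (h : IsLeftDenominatorSet S) : Type u :=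
  letI := h.oreSet
  OreLocalization S R

/-- The canonical ring homomorphism `R → S⁻¹R`, `r ↦ r / 1`. -/
noncomputable def toLocalization (S : Submonoid R) (h : IsLeftDenominatorSet S) :
    R →+* LeftLocalization S h :=
  letI := h.oreSet
  OreLocalization.numeratorRingHom

/-- The submonoid generated by a family of left denominator sets is a left denominator set as
soon as it does not contain `0`. -/
theorem isLeftDenominatorSet_sSup {F : Set (Submonoid R)}
    (hF : ∀ S ∈ F, IsLeftDenominatorSet S) (h0 : (0 : R) ∉ sSup F) :
    IsLeftDenominatorSet (sSup F) := by
  have key1 : sSup F ≤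
      { carrier := {s : R | ∀ r : R, ∃ s' ∈ sSup F, ∃ r' : R, s' * r = r' * s}
        one_mem' := fun r => ⟨1, one_mem _, r, by rw [one_mul, mul_one]⟩
        mul_mem' := by
          intro a b ha hb r
          obtain ⟨t, ht, r₁, e₁⟩ := hb r
          obtain ⟨s, hs, r₂, e₂⟩ := ha r₁
          exact ⟨s * t, mul_mem hs ht, r₂, by
            rw [mul_assoc, e₁, ← mul_assoc, e₂, mul_assoc]⟩ } := by
    refine sSup_le fun S hS s hs r => ?_
    obtain ⟨s', hs', r', e⟩ := (hF S hS).ore r s hs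
    exact ⟨s', le_sSup hS hs', r', e⟩
  have key2 : sSup F ≤
      { carrier := {s : R | ∀ r : R, r * s = 0 → r ∈ ass (sSup F)}
        one_mem' := fun r hr => ⟨1, one_mem _, by rw [one_mul, ← mul_one r, hr]⟩
        mul_mem' := by
          intro a b ha hb r hr
          obtain ⟨t, ht, e₁⟩ := hb (r * a) (by rw [mul_assoc, hr])
          obtain ⟨s, hs, e₂⟩ := ha (t * r) (by rw [mul_assoc, e₁])
          exact ⟨s * t, mul_mem hs ht, by rw [mul_assoc, e₂]⟩ } := by
    refine sSup_le fun S hS s hs r hr => ?_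
    obtain ⟨s', hs', e⟩ := (hF S hS).reversible r s hs hr
    exact ⟨s', le_sSup hS hs', e⟩
  exact ⟨⟨h0, fun r s hs => key1 hs r⟩, fun r s hs => key2 hs r⟩

theorem isLeftDenominatorSet_bot [Nontrivial R] : IsLeftDenominatorSet (⊥ : Submonoid R) := by
  refine ⟨⟨fun h => zero_ne_one (Submonoid.mem_bot.1 h), fun r s hs => ?_⟩, fun r s hs e => ?_⟩
  · rw [Submonoid.mem_bot] at hs
    exact ⟨1, one_mem _, r, by rw [hs, one_mul, mul_one]⟩
  · rw [Submonoid.mem_bot] at hs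
    exact ⟨1, one_mem _, by rw [one_mul, ← e, hs, mul_one]⟩

variable (R)

/-- The set of maximal left denominator sets of `R`. -/
def maxDen : Set (Submonoid R) := {S | Maximal IsLeftDenominatorSet S}

theorem maxDen_nonempty [Nontrivial R] : (maxDen R).Nonempty := by
  obtain ⟨M, -, hM⟩ := zorn_le_nonempty₀ {S : Submonoid R | IsLeftDenominatorSet S}
    (fun c hc hch y hy => ⟨sSup c, isLeftDenominatorSet_sSup (fun S hS => hc hS) (fun h0 => by
      obtain ⟨S, hS, h⟩ := (Submonoid.mem_sSup_of_directedOn ⟨y, hy⟩ hch.directedOn).1 h0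
      exact (hc hS).zero_notMem h), fun S hS => le_sSup hS⟩) ⊥ isLeftDenominatorSet_bot
  exact ⟨M, hM⟩

/-- The set of strongly left localizable elements: the intersection of all maximal left
denominator sets. -/
def stronglyLocalizable : Submonoid R := sInf (maxDen R)

/-- The largest left denominator set `S` of `R` with `ass S = 0`. -/
def largestRegularOre : Submonoid R :=
  sSup {S : Submonoid R | IsLeftDenominatorSet S ∧ ass S = {0}}

theorem largestRegularOre_le : largestRegularOre R ≤ nonZeroDivisors R := by
  refine sSup_le fun S hS s hs => mem_nonZeroDivisors_iff.2 ⟨fun r hr => ?_, fun r hr => ?_⟩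
  · have h : r ∈ ass S := ⟨s, hs, hr⟩
    rwa [hS.2] at h
  · have h : r ∈ ass S := hS.1.reversible r s hs hr
    rwa [hS.2] at h

/-- The set `largestRegularOre R` is indeed the largest one. -/
theorem isGreatest_largestRegularOre [Nontrivial R] :
    IsGreatest {S : Submonoid R | IsLeftDenominatorSet S ∧ ass S = {0}}
      (largestRegularOre R) := by
  refine ⟨⟨isLeftDenominatorSet_sSup (fun S hS => hS.1) fun h0 =>
    zero_notMem_nonZeroDivisors (largestRegularOre_le R h0), ?_⟩, fun S hS => le_sSup hS⟩
  ext r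
  constructor
  · rintro ⟨s, hs, e⟩
    exact (mem_nonZeroDivisors_iff.1 (largestRegularOre_le R hs)).1 r e
  · rintro rfl
    exact ⟨1, one_mem _, mul_zero 1⟩

/-- The largest strong left denominator set `T_l(R)`: the largest left denominator set of `R`
that is contained in the set of strongly left localizable elements. -/
def largestStrongDen : Submonoid R :=
  sSup {S : Submonoid R | IsLeftDenominatorSet S ∧ S ≤ stronglyLocalizable R}

/-- The set `largestStrongDen R` is indeed the largest one. -/
theorem isGreatest_largestStrongDen [Nontrivial R] :
    IsGreatest {S : Submonoid R | IsLeftDenominatorSet S ∧ S ≤ stronglyLocalizable R}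
      (largestStrongDen R) := by
  have hle : largestStrongDen R ≤ stronglyLocalizable R := sSup_le fun S hS => hS.2
  obtain ⟨M, hM⟩ := maxDen_nonempty R
  exact ⟨⟨isLeftDenominatorSet_sSup (fun S hS => hS.1) fun h0 =>
    hM.prop.zero_notMem ((sInf_le hM : stronglyLocalizable R ≤ M) (hle h0)), hle⟩,
    fun S hS => le_sSup hS⟩

/-- If the set of regular elements is a left Ore set, then it is a left denominator set. -/
theorem isLeftDenominatorSet_nonZeroDivisors {R : Type u} [Ring R]
    (h : IsLeftOreSet (nonZeroDivisors R)) : IsLeftDenominatorSet (nonZeroDivisors R) :=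
  ⟨h, fun r s hs e => ⟨1, one_mem _, by
    rw [one_mul]; exact (mem_nonZeroDivisors_iff.1 hs).2 r e⟩⟩

/-- The classical left quotient ring `Q_{l,cl}(R)`, which exists if the set of regular elements
is a left Ore set. -/
noncomputable abbrev ClassicalQuotient (h : IsLeftOreSet (nonZeroDivisors R)) : Type u :=
  LeftLocalization (nonZeroDivisors R) (isLeftDenominatorSet_nonZeroDivisors h)

/-- The largest left quotient ring `Q_l(R)`. -/
noncomputable abbrev LargestQuotient [Nontrivial R] : Type u :=
  LeftLocalization (largestRegularOre R) (isGreatest_largestRegularOre R).1.1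

/-- The largest strong left quotient ring `Q_l^s(R)`. -/
noncomputable abbrev LargestStrongQuotient [Nontrivial R] : Type u :=
  LeftLocalization (largestStrongDen R) (isGreatest_largestStrongDen R).1.1

/-- The strong left localization radical of `R`, i.e. the ideal `ass (T_l(R))`. -/
def strongRadical [Nontrivial R] : TwoSidedIdeal R :=
  (isGreatest_largestStrongDen R).1.1.toIsLeftOreSet.assIdeal

/-- The canonical map from `R` to `Q_{l,cl}(R)`. -/
noncomputable abbrev toClassical (h : IsLeftOreSet (nonZeroDivisors R)) :
    R →+* ClassicalQuotient R h :=
  toLocalization _ _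

/-- The canonical map from `R` to `Q_l(R)`. -/
noncomputable abbrev toLargest [Nontrivial R] : R →+* LargestQuotient R :=
  toLocalization _ _

/-- The canonical map from `R` to `Q_l^s(R)`. -/
noncomputable abbrev toLargestStrong [Nontrivial R] : R →+* LargestStrongQuotient R :=
  toLocalization _ _

end StrongQuot

/-!
Let `S` be a left denominator set of `R` with `ass S = 0` and semisimple localization
`Q = S⁻¹R ⊇ R`. The three conditions say that such an `S` exists and is `C_R` (the set of regular
elements), `S_{l,0}(R)` or `T_l(R)`, respectively. So it suffices to show that `S` forces the set
`C_R` to be left Ore and `C_R = T_l(R) = L^s_l(R)`; that `C_R = S_{l,0}(R)` once `C_R` is left Ore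
is immediate. All isomorphisms then are identities, since the denominator sets coincide.

Regular elements of `R` are units of `Q`, because `Q` is left artinian
(`IsLeftFractionRing.isUnit_of_mem_nonZeroDivisors`). This gives the Ore condition for `C_R`.

To compare `C_R` with the maximal left denominator sets, consider for a central idempotent `e ≠ 0`
of `Q` the set `cornerUnits f e` of all elements of `R` that are units in the corner ring `Q e`.
It is a left denominator set (`isLeftDenominatorSet_cornerUnits`). Conversely, let `M` be any left
denominator set. The fractions with numerator in `ass M` form a two-sided ideal of `Q`, generated
by a central idempotent `d`; some `m ∈ M` satisfies `m d = 0`, which implies `d ≠ 1` and that right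
multiplication by elements of `M` is injective on `Q (1 - d)`, so that `M ≤ cornerUnits f (1 - d)`
(`exists_le_cornerUnits`). Hence every maximal left denominator set has the form `cornerUnits f e`.
In particular it contains `C_R`, i.e. `C_R ≤ L^s_l(R)`.

Finally, by maximality every nonzero corner `Q e` contains a nonzero corner `Q d` in which all of
`L^s_l(R)` is invertible (`exists_mul_eq_and_le_cornerUnits`). By the descending chain condition
`L^s_l(R)` is invertible in `Q`, hence regular in `R`.
-/

namespace StrongQuot

variable {R : Type*} [Ring R] {Q : Type*} [Ring Q]

/-! ### Two-sided ideals of a semisimple ring -/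

/-- A semisimple ring is semiprime. -/
theorem eq_zero_of_forall_mul_mul_eq_zero [IsSemisimpleRing Q] {x : Q}
    (h : ∀ y, x * y * x = 0) : x = 0 := by
  obtain ⟨e, he, hI⟩ := IsSemisimpleRing.ideal_eq_span_idempotent (Ideal.span {x})
  obtain ⟨a, ha⟩ := Ideal.mem_span_singleton'.1 (hI ▸ Ideal.mem_span_singleton_self x)
  obtain ⟨b, hb⟩ := Ideal.mem_span_singleton'.1 (hI.symm ▸ Ideal.mem_span_singleton_self e)
  -- `x` generates the same left ideal as the idempotent `e = b * x`, so `x = x * e = x * b * x`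
  have hxe : x * e = x := by rw [← ha, mul_assoc, he.eq]
  rw [← hxe, ← hb, ← mul_assoc, h]

theorem exists_central_idempotent_of_isTwoSided [IsSemisimpleRing Q] (I : Ideal Q)
    [I.IsTwoSided] : ∃ e : Q, IsIdempotentElem e ∧ (∀ q, Commute e q) ∧ I = Ideal.span {e} := by
  obtain ⟨e, he, hI⟩ := IsSemisimpleRing.ideal_eq_span_idempotent I
  have heI : e ∈ I := hI ▸ Ideal.mem_span_singleton_self e
  have hx : ∀ x ∈ I, x * e = x := by
    intro x hx
    rw [hI] at hx
    obtain ⟨a, rfl⟩ := Ideal.mem_span_singleton'.1 hx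
    rw [mul_assoc, he.eq]
  -- `e` is a right identity of `I`, so `e * q = e * q * e`; it remains to see `q * e = e * q * e`
  refine ⟨e, he, fun q => ?_, hI⟩
  have h1 : e * q * e = e * q := hx _ (I.mul_mem_right q heI)
  -- the element `(1 - e) * q * e` generates a left ideal of square zero
  have h2 : q * e - e * q * e = 0 := by
    refine eq_zero_of_forall_mul_mul_eq_zero fun y => ?_
    have h3 : e * y * e = e * y := hx _ (I.mul_mem_right y heI)
    have h4 : e * (q * e - e * q * e) = 0 := by
      simp only [mul_sub, ← mul_assoc, he.eq, sub_self]
    have h5 : (q * e - e * q * e) * y = (q - e * q) * (e * y * e) := by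
      rw [h3, sub_mul, sub_mul]; simp only [mul_assoc]
    rw [h5, mul_assoc (q - e * q), mul_assoc (e * y), h4, mul_zero, mul_zero]
  exact h1.symm.trans (sub_eq_zero.1 h2).symm

/-! ### Corners at central idempotents -/

/-- For a central idempotent `e` of `Q`, the map `q ↦ q * e + (1 - e)`, i.e. the projection of
`Q = Q e × Q (1 - e)` onto the first factor, followed by the inclusion `a ↦ (a, 1)`. It replaces
the corner ring `Q e`: an element `q * e` is a unit of `Q e` if and only if the value at `q` is
a unit of `Q`. -/
def cornerHom (e : Q) (he : IsIdempotentElem e) (hc : ∀ q, Commute e q) : Q →* Q where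
  toFun q := q * e + (1 - e)
  map_one' := by rw [one_mul, add_sub_cancel]
  map_mul' x y := by
    have h1 : x * e * (y * e) = x * y * e := by
      rw [mul_assoc, ← mul_assoc e y, (hc y).eq, mul_assoc y, he.eq, mul_assoc]
    have h2 : x * e * (1 - e) = 0 := by rw [mul_assoc, he.mul_one_sub_self, mul_zero]
    have h3 : (1 - e) * (y * e) = 0 := by
      rw [← (hc y).eq, ← mul_assoc, he.one_sub_mul_self, zero_mul]
    rw [add_mul, mul_add, mul_add, h1, h2, h3, he.one_sub.eq, add_zero, zero_add]

theorem cornerHom_apply (e : Q) (he : IsIdempotentElem e) (hc : ∀ q, Commute e q) (q : Q) :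
    cornerHom e he hc q = q * e + (1 - e) := rfl

theorem mul_cornerHom (e : Q) (he : IsIdempotentElem e) (hc : ∀ q, Commute e q) (q : Q) :
    e * cornerHom e he hc q = q * e := by
  rw [cornerHom_apply, mul_add, he.mul_one_sub_self, add_zero, ← mul_assoc, (hc q).eq, mul_assoc,
    he.eq]

theorem cornerHom_mul (e : Q) (he : IsIdempotentElem e) (hc : ∀ q, Commute e q) (q : Q) :
    cornerHom e he hc q * e = q * e := by
  rw [← (hc _).eq, mul_cornerHom]

/-- The elements of `R` that become invertible in the corner ring `Q e` under `f : R → Q`. -/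
def cornerUnits (f : R →+* Q) (e : Q) (he : IsIdempotentElem e) (hc : ∀ q, Commute e q) :
    Submonoid R :=
  (IsUnit.submonoid Q).comap ((cornerHom e he hc).comp (f : R →* Q))

theorem mem_cornerUnits {f : R →+* Q} {e : Q} {he : IsIdempotentElem e}
    {hc : ∀ q, Commute e q} {r : R} :
    r ∈ cornerUnits f e he hc ↔ IsUnit (cornerHom e he hc (f r)) := Iff.rfl

theorem mem_cornerUnits_of_isUnit {f : R →+* Q} {e : Q} (he : IsIdempotentElem e)
    (hc : ∀ q, Commute e q) {r : R} (h : IsUnit (f r)) : r ∈ cornerUnits f e he hc :=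
  h.map (cornerHom e he hc)

/-! ### Rings of left fractions -/

/-- The ring homomorphism `f : R → Q` is injective and exhibits `Q` as a ring of left fractions
`s⁻¹ r` with denominators in `S`. -/
structure IsLeftFractionRing (S : Submonoid R) (f : R →+* Q) : Prop where
  injective : Function.Injective f
  isUnit : ∀ s ∈ S, IsUnit (f s)
  exists_num : ∀ q : Q, ∃ s ∈ S, ∃ r : R, f s * q = f r

namespace IsLeftFractionRing

variable {S : Submonoid R} {f : R →+* Q} (hf : IsLeftFractionRing S f)
include hf

theorem ore (r : R) {s : R} (hs : IsUnit (f s)) : ∃ t ∈ S, ∃ r' : R, t * r = r' * s := by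
  obtain ⟨u, hu⟩ := hs
  obtain ⟨t, ht, r', e⟩ := hf.exists_num (f r * ↑u⁻¹)
  refine ⟨t, ht, r', hf.injective ?_⟩
  rw [map_mul, map_mul, ← e, ← hu, mul_assoc, mul_assoc, Units.inv_mul, mul_one]

/-- Right multiplication by a regular element of `R` is injective on `Q`, because only numerators
matter; the descending chain condition then makes the element a unit. -/
theorem isUnit_of_mem_nonZeroDivisors [IsArtinianRing Q] {c : R}
    (hcr : c ∈ nonZeroDivisors R) : IsUnit (f c) := by
  rw [IsArtinianRing.isUnit_iff_isRightRegular, isRightRegular_iff_left_eq_zero_of_mul]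
  intro q hq
  obtain ⟨s, hs, r, e⟩ := hf.exists_num q
  have hr : r * c = 0 := hf.injective (by rw [map_mul, ← e, mul_assoc, hq, mul_zero, map_zero])
  rw [(mem_nonZeroDivisors_iff.1 hcr).2 r hr, map_zero] at e
  exact (hf.isUnit s hs).mul_right_eq_zero.1 e

theorem mem_nonZeroDivisors_of_isUnit {c : R} (h : IsUnit (f c)) : c ∈ nonZeroDivisors R := by
  refine mem_nonZeroDivisors_iff.2 ⟨fun r hr => hf.injective ?_, fun r hr => hf.injective ?_⟩
  · rw [map_zero]
    exact h.mul_right_eq_zero.1 (by rw [← map_mul, hr, map_zero])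
  · rw [map_zero]
    exact h.mul_left_eq_zero.1 (by rw [← map_mul, hr, map_zero])

theorem isLeftOreSet_nonZeroDivisors [Nontrivial R] [IsArtinianRing Q] :
    IsLeftOreSet (nonZeroDivisors R) := by
  refine ⟨zero_notMem_nonZeroDivisors, fun r s hs => ?_⟩
  obtain ⟨t, ht, r', e⟩ := hf.ore r (hf.isUnit_of_mem_nonZeroDivisors hs)
  exact ⟨t, hf.mem_nonZeroDivisors_of_isUnit (hf.isUnit t ht), r', e⟩

/-! ### Maximal left denominator sets as corner units -/

/-- A numerator of a central idempotent `e` is an element of `cornerUnits f e` which vanishes in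
the complementary corner. -/
theorem exists_mem_cornerUnits_mul_eq {e : Q} (he : IsIdempotentElem e)
    (hc : ∀ q, Commute e q) : ∃ b ∈ cornerUnits f e he hc, f b * e = f b := by
  obtain ⟨t, ht, b, hb⟩ := hf.exists_num e
  have hbe : f b * e = f b := by rw [← hb, mul_assoc, he.eq]
  refine ⟨b, ?_, hbe⟩
  have := mem_cornerUnits_of_isUnit he hc (hf.isUnit t ht)
  rwa [mem_cornerUnits, cornerHom_apply, hb, ← hbe, ← cornerHom_apply e he hc] at this

/-- Multiplication by an element `b` as in `exists_mem_cornerUnits_mul_eq` lifts identities from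
the corner `Q e` to `R`, so the Ore condition and reversibility may be checked in `Q e`. -/
theorem isLeftDenominatorSet_cornerUnits {e : Q} (he : IsIdempotentElem e)
    (hc : ∀ q, Commute e q) (hne : e ≠ 0) : IsLeftDenominatorSet (cornerUnits f e he hc) := by
  obtain ⟨b, hb, hbe⟩ := hf.exists_mem_cornerUnits_mul_eq he hc
  refine ⟨⟨fun h0 => hne ?_, fun r c hcm => ?_⟩, fun r c hcm hrc => ⟨b, hb, hf.injective ?_⟩⟩
  · refine (mem_cornerUnits.1 h0).mul_left_eq_zero.1 ?_
    rw [mul_cornerHom, map_zero, zero_mul]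
  · obtain ⟨v, hv⟩ := mem_cornerUnits.1 hcm
    obtain ⟨t, ht, r', h⟩ := hf.exists_num (f r * ↑v⁻¹)
    -- `t * r` and `r' * c` have the same image in the corner `Q e`; `b` kills the difference
    have h1 : f t * f r = f r' * ↑v := by
      rw [← h, mul_assoc, mul_assoc, Units.inv_mul, mul_one]
    have h2 : e * (f t * f r) = e * (f r' * f c) := by
      rw [h1, hv, (hc _).eq, mul_assoc, cornerHom_mul, ← mul_assoc, ← (hc _).eq]
    refine ⟨b * t, mul_mem hb (mem_cornerUnits_of_isUnit he hc (hf.isUnit t ht)), b * r',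
      hf.injective ?_⟩
    simp only [map_mul]
    rw [mul_assoc, mul_assoc, ← hbe, mul_assoc, mul_assoc, h2]
  · have h1 : f r * e = 0 := by
      refine (mem_cornerUnits.1 hcm).mul_left_eq_zero.1 ?_
      rw [mul_assoc, mul_cornerHom, ← mul_assoc, ← map_mul, hrc, map_zero, zero_mul]
    rw [map_mul, map_zero, ← hbe, mul_assoc, (hc _).eq, h1, mul_zero]

/-- The left ideal of all fractions whose numerator lies in a given two-sided ideal `a`. -/
def extension (a : TwoSidedIdeal R) : Ideal Q where
  carrier := {q | ∃ s ∈ S, ∃ r ∈ a, f s * q = f r}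
  zero_mem' := ⟨1, one_mem _, 0, a.zero_mem, by rw [mul_zero, map_zero]⟩
  add_mem' := by
    rintro x y ⟨s, hs, r, hr, e⟩ ⟨t, ht, r', hr', e'⟩
    obtain ⟨u, hu, v, h⟩ := hf.ore s (hf.isUnit t ht)
    refine ⟨u * s, mul_mem hu hs, u * r + v * r',
      a.add_mem (a.mul_mem_left _ _ hr) (a.mul_mem_left _ _ hr'), ?_⟩
    rw [mul_add, map_add, map_mul f u r, map_mul f v r', ← e, ← e', ← mul_assoc, ← mul_assoc,
      ← map_mul, ← map_mul, h]
  smul_mem' := by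
    rintro p x ⟨s, hs, r, hr, e⟩
    obtain ⟨u, hu⟩ := hf.isUnit s hs
    obtain ⟨t, ht, r', h⟩ := hf.exists_num (p * ↑u⁻¹)
    refine ⟨t, ht, r' * r, a.mul_mem_left _ _ hr, ?_⟩
    rw [map_mul, ← h, ← e, ← hu, smul_eq_mul, mul_assoc, mul_assoc, Units.inv_mul_cancel_left]

/-- Right multiplication by a denominator is an injective endomorphism of the artinian left
module `hf.extension a`, hence an automorphism. -/
theorem isTwoSided_extension [IsArtinianRing Q] (a : TwoSidedIdeal R) :
    (hf.extension a).IsTwoSided := by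
  have hR : ∀ x ∈ hf.extension a, ∀ r : R, x * f r ∈ hf.extension a := by
    rintro x ⟨s, hs, r, hr, e⟩ r'
    exact ⟨s, hs, r * r', a.mul_mem_right _ _ hr, by rw [← mul_assoc, e, map_mul]⟩
  refine ⟨fun {x} p hx => ?_⟩
  obtain ⟨s, hs, r, e⟩ := hf.exists_num p
  obtain ⟨u, hu⟩ := hf.isUnit s hs
  let φ : hf.extension a →ₗ[Q] hf.extension a :=
    { toFun := fun y => ⟨y * f s, hR y y.2 s⟩
      map_add' := fun y z => Subtype.ext (add_mul _ _ _)
      map_smul' := fun y z => Subtype.ext (mul_assoc _ _ _) }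
  have hφ : Function.Injective φ := fun y z h =>
    Subtype.ext ((hf.isUnit s hs).mul_left_injective (congrArg Subtype.val h))
  obtain ⟨y, hy⟩ := IsArtinian.surjective_of_injective_endomorphism φ hφ ⟨x, hx⟩
  have hy' : (y : Q) * f s = x := congrArg Subtype.val hy
  rw [← hy', mul_assoc, e]
  exact hR y y.2 r

/-- The denominators of a left denominator set `M` become invertible in the corner `Q e`, where
`1 - e` generates the extension of `ass M` to `Q`. -/
theorem exists_le_cornerUnits [IsSemisimpleRing Q] {M : Submonoid R}
    (hM : IsLeftDenominatorSet M) :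
    ∃ (e : Q) (he : IsIdempotentElem e) (hc : ∀ q, Commute e q), e ≠ 0 ∧
      M ≤ cornerUnits f e he hc := by
  have := hf.isTwoSided_extension hM.assIdeal
  obtain ⟨d, hd, hdc, hI⟩ := exists_central_idempotent_of_isTwoSided (hf.extension hM.assIdeal)
  obtain ⟨s, hs, a, ha, hsa⟩ : d ∈ hf.extension hM.assIdeal :=
    hI ▸ Ideal.mem_span_singleton_self d
  obtain ⟨m, hm, hma⟩ := (hM.mem_assIdeal a).1 ha
  have hmd : f m * d = 0 := by
    refine (hf.isUnit s hs).mul_left_eq_zero.1 ?_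
    rw [mul_assoc, (hdc _).eq, hsa, ← map_mul, hma, map_zero]
  refine ⟨1 - d, hd.one_sub, fun q => (Commute.one_left q).sub_left (hdc q), fun h => ?_,
    fun x hx => ?_⟩
  · rw [← sub_eq_zero.1 h, mul_one] at hmd
    exact hM.zero_notMem (hf.injective (hmd.trans (map_zero f).symm) ▸ hm)
  · rw [mem_cornerUnits, IsArtinianRing.isUnit_iff_isRightRegular,
      isRightRegular_iff_left_eq_zero_of_mul]
    intro q hq
    rw [cornerHom_apply, sub_sub_cancel] at hq
    -- both components of `q` in `Q = Q (1 - d) × Q d` vanish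
    have hqd : q * d = 0 := by
      have := congrArg (· * d) hq
      simpa only [mul_add, add_mul, mul_assoc, hd.one_sub_mul_self, hd.eq, mul_zero, zero_add,
        zero_mul] using this
    have hqx : q * f x * (1 - d) = 0 := by
      rwa [mul_add, hqd, add_zero, ← mul_assoc] at hq
    obtain ⟨t, ht, r, hr⟩ := hf.exists_num q
    have h1 : m * r * x = 0 := by
      refine hf.injective ?_
      have h2 : f r * f x = f r * f x * d := by
        rw [← sub_eq_zero, ← mul_one_sub, ← hr, mul_assoc, mul_assoc, ← mul_assoc q, hqx, mul_zero]
      rw [map_mul, map_mul, mul_assoc, h2, ← (hdc _).eq, ← mul_assoc, hmd, zero_mul, map_zero]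
    obtain ⟨m', hm', h2⟩ := hM.reversible _ x hx h1
    have hqI : q ∈ hf.extension hM.assIdeal :=
      ⟨t, ht, r, (hM.mem_assIdeal r).2 ⟨m' * m, mul_mem hm' hm, by rw [mul_assoc, h2]⟩, hr⟩
    rw [hI] at hqI
    obtain ⟨p, rfl⟩ := Ideal.mem_span_singleton'.1 hqI
    rw [← hqd, mul_assoc, hd.eq]

theorem exists_eq_cornerUnits_of_maximal [IsSemisimpleRing Q] {M : Submonoid R}
    (hM : M ∈ maxDen R) :
    ∃ (e : Q) (he : IsIdempotentElem e) (hc : ∀ q, Commute e q), e ≠ 0 ∧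
      M = cornerUnits f e he hc := by
  obtain ⟨e, he, hc, hne, hle⟩ := hf.exists_le_cornerUnits hM.prop
  exact ⟨e, he, hc, hne, hM.eq_of_le (hf.isLeftDenominatorSet_cornerUnits he hc hne) hle⟩

theorem nonZeroDivisors_le_stronglyLocalizable [IsSemisimpleRing Q] :
    nonZeroDivisors R ≤ stronglyLocalizable R := by
  refine le_sInf fun M hM x hx => ?_
  obtain ⟨e, he, hc, -, rfl⟩ := hf.exists_eq_cornerUnits_of_maximal hM
  exact mem_cornerUnits_of_isUnit he hc (hf.isUnit_of_mem_nonZeroDivisors hx)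

end IsLeftFractionRing

/-! ### Strongly left localizable elements are regular -/

theorem exists_le_maxDen {S : Submonoid R} (hS : IsLeftDenominatorSet S) :
    ∃ M ∈ maxDen R, S ≤ M := by
  obtain ⟨M, hSM, hM⟩ := zorn_le_nonempty₀ {S : Submonoid R | IsLeftDenominatorSet S}
    (fun c hc hch y hy => ⟨sSup c, isLeftDenominatorSet_sSup (fun S hS => hc hS) (fun h0 => by
      obtain ⟨S, hS, h⟩ := (Submonoid.mem_sSup_of_directedOn ⟨y, hy⟩ hch.directedOn).1 h0
      exact (hc hS).zero_notMem h), fun S hS => le_sSup hS⟩) S hS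
  exact ⟨M, hM, hSM⟩

namespace IsLeftFractionRing

variable {S : Submonoid R} {f : R →+* Q} (hf : IsLeftFractionRing S f)
include hf

/-- Every nonzero corner contains a nonzero corner in which all strongly left localizable elements
are invertible. -/
theorem exists_mul_eq_and_le_cornerUnits [IsSemisimpleRing Q] {e : Q} (he : IsIdempotentElem e)
    (hc : ∀ q, Commute e q) (hne : e ≠ 0) :
    ∃ (d : Q) (hd : IsIdempotentElem d) (hdc : ∀ q, Commute d q), d ≠ 0 ∧ d * e = d ∧
      stronglyLocalizable R ≤ cornerUnits f d hd hdc := by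
  obtain ⟨M, hM, hle⟩ := exists_le_maxDen (hf.isLeftDenominatorSet_cornerUnits he hc hne)
  obtain ⟨d, hd, hdc, hd0, rfl⟩ := hf.exists_eq_cornerUnits_of_maximal hM
  obtain ⟨b, hb, hbe⟩ := hf.exists_mem_cornerUnits_mul_eq he hc
  refine ⟨d, hd, hdc, hd0, ?_, sInf_le hM⟩
  -- `b` is invertible in the corner `Q d` and vanishes in `Q (1 - e)`
  have h : (d - d * e) * cornerHom d hd hdc (f b) = 0 := by
    rw [← mul_one_sub, (hdc _).eq, mul_assoc, mul_cornerHom, ← mul_assoc, one_sub_mul, (hc _).eq,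
      hbe, sub_self, zero_mul]
  exact (sub_eq_zero.1 ((mem_cornerUnits.1 (hle hb)).mul_left_eq_zero.1 h)).symm

/-- A strongly left localizable element is invertible in every corner `Q e`, in particular in
`Q` itself: otherwise take a minimal counterexample `e` and split off a corner `Q d` as in
`exists_mul_eq_and_le_cornerUnits`; the element is invertible in `Q d` and in `Q (e - d)`. -/
theorem stronglyLocalizable_le_nonZeroDivisors [IsSemisimpleRing Q] :
    stronglyLocalizable R ≤ nonZeroDivisors R := by
  intro x hx
  refine hf.mem_nonZeroDivisors_of_isUnit ?_
  have key : ∀ (I : Ideal Q) (e : Q) (he : IsIdempotentElem e) (hc : ∀ q, Commute e q),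
      Ideal.span {e} = I → x ∈ cornerUnits f e he hc := by
    intro I
    induction I using WellFoundedLT.induction with
    | ind I ih =>
      rintro e he hc rfl
      by_cases hne : e = 0
      · subst hne
        rw [mem_cornerUnits, cornerHom_apply, mul_zero, sub_zero, zero_add]
        exact isUnit_one
      obtain ⟨d, hd, hdc, hd0, hde, hle⟩ := hf.exists_mul_eq_and_le_cornerUnits he hc hne
      have hed : e * d = d := by rw [(hc d).eq, hde]
      have hc' : ∀ q, Commute (e - d) q := fun q => (hc q).sub_left (hdc q)
      have he' : IsIdempotentElem (e - d) := by
        rw [IsIdempotentElem, mul_sub, sub_mul, sub_mul, he.eq, hd.eq, hde, hed, sub_self,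
          sub_zero]
      have hlt : Ideal.span {e - d} < Ideal.span {e} := by
        refine lt_of_le_not_ge ?_ fun hge => hd0 ?_
        · rw [Ideal.span_singleton_le_iff_mem, Ideal.mem_span_singleton']
          exact ⟨1 - d, by rw [one_sub_mul, hde]⟩
        · rw [Ideal.span_singleton_le_iff_mem, Ideal.mem_span_singleton'] at hge
          obtain ⟨y, hy⟩ := hge
          rw [← hed, ← hy, mul_assoc, sub_mul, hed, hd.eq, sub_self, mul_zero]
      have h1 := mem_cornerUnits.1 (ih _ hlt (e - d) he' hc' rfl)
      have h2 := mem_cornerUnits.1 (hle hx)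
      have h3 : cornerHom d hd hdc (f x) * cornerHom (e - d) he' hc' (f x) =
          cornerHom e he hc (f x) := by
        have h4 : d * (f x * (e - d)) = 0 := by
          rw [← mul_assoc, (hdc _).eq, mul_assoc, mul_sub, hde, hd.eq, sub_self, mul_zero]
        have h5 : d * cornerHom (e - d) he' hc' (f x) = d := by
          rw [cornerHom_apply, mul_add, h4, zero_add, mul_sub, mul_sub, hde, hd.eq, sub_self,
            sub_zero, mul_one]
        rw [cornerHom_apply d, add_mul, mul_assoc, sub_mul, h5, one_mul, cornerHom_apply,
          cornerHom_apply, mul_sub]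
        abel
      rw [mem_cornerUnits, ← h3]
      exact h2.mul h1
  have h1 := mem_cornerUnits.1 (key _ 1 IsIdempotentElem.one Commute.one_left rfl)
  rwa [cornerHom_apply, mul_one, sub_self, add_zero] at h1

theorem stronglyLocalizable_eq [IsSemisimpleRing Q] :
    stronglyLocalizable R = nonZeroDivisors R :=
  le_antisymm hf.stronglyLocalizable_le_nonZeroDivisors hf.nonZeroDivisors_le_stronglyLocalizable

theorem largestStrongDen_eq [Nontrivial R] [IsSemisimpleRing Q] :
    largestStrongDen R = nonZeroDivisors R := by
  refine le_antisymm ?_ ?_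
  · exact (isGreatest_largestStrongDen R).1.2.trans hf.stronglyLocalizable_le_nonZeroDivisors
  · exact (isGreatest_largestStrongDen R).2
      ⟨isLeftDenominatorSet_nonZeroDivisors hf.isLeftOreSet_nonZeroDivisors,
        hf.nonZeroDivisors_le_stronglyLocalizable⟩

end IsLeftFractionRing

theorem ass_nonZeroDivisors : ass (nonZeroDivisors R) = {0} := by
  ext r
  constructor
  · rintro ⟨s, hs, e⟩
    exact (mem_nonZeroDivisors_iff.1 hs).1 r e
  · rintro rfl
    exact ⟨1, one_mem _, mul_zero 1⟩

theorem largestRegularOre_eq [Nontrivial R] (h : IsLeftOreSet (nonZeroDivisors R)) :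
    largestRegularOre R = nonZeroDivisors R :=
  le_antisymm (largestRegularOre_le R) ((isGreatest_largestRegularOre R).2
    ⟨isLeftDenominatorSet_nonZeroDivisors h, ass_nonZeroDivisors⟩)

/-! ### Localizations at left denominator sets -/

/-- The localization at a left denominator set `S` with `ass S = 0` is a ring of left fractions of
`R` in the sense of `IsLeftFractionRing`. -/
theorem isLeftFractionRing_toLocalization {S : Submonoid R} (h : IsLeftDenominatorSet S)
    (hass : ass S = {0}) : IsLeftFractionRing S (toLocalization S h) := by
  let _ := h.oreSet
  refine ⟨OreLocalization.numeratorHom_inj fun s hs r hr => ?_,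
    fun s hs => OreLocalization.numerator_isUnit (⟨s, hs⟩ : S), fun q => ?_⟩
  · have : r ∈ ass S := ⟨s, hs, hr⟩
    rwa [hass] at this
  · induction q using OreLocalization.ind with
    | _ r s => exact ⟨s, s.2, r, OreLocalization.mul_cancel⟩

theorem exists_ringEquiv_of_eq {S T : Submonoid R} (hS : IsLeftDenominatorSet S)
    (hT : IsLeftDenominatorSet T) (h : S = T) :
    ∃ e : LeftLocalization S hS ≃+* LeftLocalization T hT,
      ∀ r, e (toLocalization S hS r) = toLocalization T hT r := by
  subst h
  exact ⟨RingEquiv.refl _, fun r => rfl⟩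

theorem strongRadical_eq_bot_iff [Nontrivial R] :
    strongRadical R = ⊥ ↔ ass (largestStrongDen R) = {0} := by
  rw [SetLike.ext_iff, Set.ext_iff]
  refine forall_congr' fun r => ?_
  rw [TwoSidedIdeal.mem_bot, Set.mem_singleton_iff]
  exact iff_congr (IsLeftOreSet.mem_assIdeal _ r) Iff.rfl

end StrongQuot

theorem theorem1p4 (R : Type*) [Ring R] [Nontrivial R] :
    List.TFAE
      [ ∃ h : StrongQuot.IsLeftOreSet (nonZeroDivisors R),
          IsSemisimpleRing (StrongQuot.ClassicalQuotient R h),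
        IsSemisimpleRing (StrongQuot.LargestQuotient R),
        IsSemisimpleRing (StrongQuot.LargestStrongQuotient R) ∧
          StrongQuot.strongRadical R = ⊥ ] ∧
    ((∃ h : StrongQuot.IsLeftOreSet (nonZeroDivisors R),
          IsSemisimpleRing (StrongQuot.ClassicalQuotient R h)) ∨
        IsSemisimpleRing (StrongQuot.LargestQuotient R) ∨
        (IsSemisimpleRing (StrongQuot.LargestStrongQuotient R) ∧
          StrongQuot.strongRadical R = ⊥) →
      ∃ h : StrongQuot.IsLeftOreSet (nonZeroDivisors R),
        (∃ e : StrongQuot.ClassicalQuotient R h ≃+* StrongQuot.LargestQuotient R,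
          ∀ r : R, e (StrongQuot.toClassical R h r) = StrongQuot.toLargest R r) ∧
        (∃ e : StrongQuot.LargestQuotient R ≃+* StrongQuot.LargestStrongQuotient R,
          ∀ r : R, e (StrongQuot.toLargest R r) = StrongQuot.toLargestStrong R r) ∧
        nonZeroDivisors R = StrongQuot.largestStrongDen R ∧
        StrongQuot.largestStrongDen R = StrongQuot.stronglyLocalizable R) := by
  have h12 : (∃ h : StrongQuot.IsLeftOreSet (nonZeroDivisors R),
      IsSemisimpleRing (StrongQuot.ClassicalQuotient R h)) →
      IsSemisimpleRing (StrongQuot.LargestQuotient R) := by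
    rintro ⟨h, hs⟩
    obtain ⟨e, -⟩ := StrongQuot.exists_ringEquiv_of_eq
      (StrongQuot.isLeftDenominatorSet_nonZeroDivisors h)
      (StrongQuot.isGreatest_largestRegularOre R).1.1 (StrongQuot.largestRegularOre_eq h).symm
    exact e.isSemisimpleRing
  have h23 : IsSemisimpleRing (StrongQuot.LargestQuotient R) →
      IsSemisimpleRing (StrongQuot.LargestStrongQuotient R) ∧ StrongQuot.strongRadical R = ⊥ := by
    intro hs
    have hf := StrongQuot.isLeftFractionRing_toLocalization
      (StrongQuot.isGreatest_largestRegularOre R).1.1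
      (StrongQuot.isGreatest_largestRegularOre R).1.2
    have hT := hf.largestStrongDen_eq
    obtain ⟨e, -⟩ := StrongQuot.exists_ringEquiv_of_eq
      (StrongQuot.isGreatest_largestRegularOre R).1.1
      (StrongQuot.isGreatest_largestStrongDen R).1.1
      ((StrongQuot.largestRegularOre_eq hf.isLeftOreSet_nonZeroDivisors).trans hT.symm)
    refine ⟨e.isSemisimpleRing, StrongQuot.strongRadical_eq_bot_iff.2 ?_⟩
    rw [hT, StrongQuot.ass_nonZeroDivisors]
  have h3 : (IsSemisimpleRing (StrongQuot.LargestStrongQuotient R) ∧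
      StrongQuot.strongRadical R = ⊥) → ∃ h : StrongQuot.IsLeftOreSet (nonZeroDivisors R),
        IsSemisimpleRing (StrongQuot.ClassicalQuotient R h) ∧
        nonZeroDivisors R = StrongQuot.largestStrongDen R ∧
        StrongQuot.largestStrongDen R = StrongQuot.stronglyLocalizable R := by
    rintro ⟨hs, hrad⟩
    have hf := StrongQuot.isLeftFractionRing_toLocalization
      (StrongQuot.isGreatest_largestStrongDen R).1.1 (StrongQuot.strongRadical_eq_bot_iff.1 hrad)
    have hT := hf.largestStrongDen_eq
    obtain ⟨e, -⟩ := StrongQuot.exists_ringEquiv_of_eq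
      (StrongQuot.isGreatest_largestStrongDen R).1.1
      (StrongQuot.isLeftDenominatorSet_nonZeroDivisors hf.isLeftOreSet_nonZeroDivisors) hT
    exact ⟨hf.isLeftOreSet_nonZeroDivisors, e.isSemisimpleRing, hT.symm,
      hT.trans hf.stronglyLocalizable_eq.symm⟩
  constructor
  · tfae_have 1 → 2 := h12
    tfae_have 2 → 3 := h23
    tfae_have 3 → 1 := fun h => let ⟨hO, hs, _⟩ := h3 h; ⟨hO, hs⟩
    tfae_finish
  · intro h
    obtain ⟨hO, -, hT, hL⟩ := h3 (h.elim (h23 ∘ h12) (Or.elim · h23 id))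
    have hC := StrongQuot.largestRegularOre_eq hO
    exact ⟨hO, StrongQuot.exists_ringEquiv_of_eq _ _ hC.symm,
      StrongQuot.exists_ringEquiv_of_eq _ _ (hC.trans hT), hT, hL⟩
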